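/- For integers $q\ge 2$ and $n\ge 0$ let $s_q(n)$ denote the sum of the digits of $n$ in its $q$-ary expansion. Let $p(x)\in\mathbb Z[x]$ have degree $h\ge 2$ and positive leading coefficient. (1) Suppose that all coefficients of $p$ are nonnegative. Then for every integer $q\ge 2$ there is a constant $c_1>0$, depending only on $p$ and $q$, such that for all integers $n\ge 2$ $$\frac{s_q(p(n))}{s_q(n)}\le c_1(\log_q n)^{1-1/h}.$$ This is best possible: there is a constant $c_1'>0$, depending only on $p$ (and not on $q$), such that for every integer $q\ge2$ $$\frac{s_q(p(n))}{s_q(n)}> c_1'(\log_q n)^{1-1/h}$$ for infinitely many positive integers $n$. (2) Suppose that $p$ has at least one negative coefficient, and let $q\ge 2$ be an integer. Then there are $c_2>0$ and $n_0\geq 1$, depending only on $p$ and $q$, such that for all integers $n\ge n_0$ we have $p(n)\ge 0$ and $$\frac{s_q(p(n))}{s_q(n)}\le c_2\log_q n.$$ This is best possible: for every $\varepsilon>0$ there are infinitely many positive integers $n$ with $p(n)\ge 0$ and $$\frac{s_q(p(n))}{s_q(n)}>(q-1-\varepsilon)\log_q n.$$ -/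

import Mathlib

open Filter

/-- The sum of the digits of the natural number `n` in its `q`-ary expansion (used for `2 ≤ q`). -/
def digitSum (q n : ℕ) : ℕ := (Nat.digits q n).sum

/-- The ratio `s_q(p(n)) / s_q(n)`; it has its meaning when `0 ≤ p(n)` and `0 < n`. -/
noncomputable def digitRatio (p : Polynomial ℤ) (q n : ℕ) : ℝ :=
  (digitSum q (p.eval (n : ℤ)).toNat : ℝ) / (digitSum q n : ℝ)

/-! Write s for the digit sum and L for log_q n. Since s is subadditive and submultiplicative,
nonnegative coefficients give s(p(n)) ≤ A s(n)^h, while counting digits gives s(p(n)) ≤ B L for any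
p. Interpolating between the two bounds yields the exponent 1 - 1/h.

For sharpness, take n = ∑ Q^(d a) with Q = q^u and d a Bose–Chowla set of l exponents below l^h.
Sums of j ≤ h exponents repeat boundedly often, so for suitable u the base-Q expansion of p(n)
involves no carries and has at least l^h / h^h nonzero digits. Meanwhile s(n) ≤ l and L = O(l^h)
(`exists_boseChowla`, `card_pow_le_mul_digitSum`).

With a negative coefficient, the upper bound is the digit count and s(n) ≥ 1. For sharpness take n =
q^k: the negative coefficient forces a borrow, which leaves a run of k - O(1) digits q - 1 in p(n),
while s(n) = 1. -/

/-! ### Arithmetic of digit sums. -/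

theorem digitSum_zero (q : ℕ) : digitSum q 0 = 0 := by simp [digitSum]

theorem digitSum_add_mul {q r : ℕ} (hq : 2 ≤ q) (hr : r < q) (m : ℕ) :
    digitSum q (r + q * m) = r + digitSum q m := by
  by_cases h : r = 0 ∧ m = 0
  · simp [h.1, h.2, digitSum]
  · rw [digitSum, Nat.digits_add q hq r m hr (by tauto)]
    simp [digitSum]

theorem digitSum_mul_base {q : ℕ} (hq : 2 ≤ q) (m : ℕ) : digitSum q (q * m) = digitSum q m := by
  simpa using digitSum_add_mul (r := 0) hq (by omega) m

theorem digitSum_of_lt {q r : ℕ} (hq : 2 ≤ q) (hr : r < q) : digitSum q r = r := by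
  simpa [digitSum_zero] using digitSum_add_mul hq hr 0

theorem digitSum_pos {q n : ℕ} (hq : 2 ≤ q) (hn : 0 < n) : 0 < digitSum q n := by
  induction n using Nat.strong_induction_on with
  | _ n ih =>
    rw [← Nat.mod_add_div n q, digitSum_add_mul hq (Nat.mod_lt _ (by omega))]
    by_cases h : n % q = 0
    · have h1 : 0 < n / q := Nat.div_pos (Nat.le_of_dvd hn (Nat.dvd_of_mod_eq_zero h)) (by omega)
      have := ih (n / q) (Nat.div_lt_self hn hq) h1
      omega
    · omega

theorem digitSum_add_mul_pow {q : ℕ} (hq : 2 ≤ q) (u r m : ℕ) (hr : r < q ^ u) :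
    digitSum q (r + q ^ u * m) = digitSum q r + digitSum q m := by
  induction u generalizing r with
  | zero =>
    obtain rfl : r = 0 := by simpa using hr
    simp [digitSum_zero]
  | succ u ih =>
    have h0 : r % q < q := Nat.mod_lt _ (by omega)
    have h1 : r / q < q ^ u := Nat.div_lt_of_lt_mul (by rwa [pow_succ'] at hr)
    have h2 : r + q ^ (u + 1) * m = r % q + q * (r / q + q ^ u * m) := by
      conv_lhs => rw [← Nat.mod_add_div r q]
      ring
    have h3 : digitSum q r = r % q + digitSum q (r / q) := by
      conv_lhs => rw [← Nat.mod_add_div r q]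
      exact digitSum_add_mul hq h0 _
    rw [h2, digitSum_add_mul hq h0, ih _ h1, h3]
    ring

theorem digitSum_pow_sub_one {q : ℕ} (hq : 2 ≤ q) (k : ℕ) :
    digitSum q (q ^ k - 1) = (q - 1) * k := by
  induction k with
  | zero => simp [digitSum_zero]
  | succ k ih =>
    have h : q ^ (k + 1) - 1 = (q - 1) + q * (q ^ k - 1) := by
      obtain ⟨x, hx⟩ : ∃ x, q ^ k = x + 1 :=
        ⟨q ^ k - 1, by have := Nat.pow_pos (n := k) (show 0 < q by omega); omega⟩
      rw [pow_succ', hx]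
      simp only [Nat.mul_add, Nat.add_sub_cancel]
      omega
    rw [h, digitSum_add_mul hq (by omega), ih]
    ring

/-- A carry replaces q units in one place by a single unit in the next, so it can only lower the
digit sum. -/
theorem digitSum_add_le {q : ℕ} (hq : 2 ≤ q) (a b : ℕ) :
    digitSum q (a + b) ≤ digitSum q a + digitSum q b := by
  induction hN : a + b using Nat.strong_induction_on generalizing a b with
  | _ N ih =>
    subst hN
    obtain ⟨r, a', hr, rfl⟩ : ∃ r a', r < q ∧ r + q * a' = a :=
      ⟨a % q, a / q, Nat.mod_lt _ (by omega), Nat.mod_add_div a q⟩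
    obtain ⟨t, b', ht, rfl⟩ : ∃ t b', t < q ∧ t + q * b' = b :=
      ⟨b % q, b / q, Nat.mod_lt _ (by omega), Nat.mod_add_div b q⟩
    have hle : 2 * (a' + b') ≤ q * (a' + b') := Nat.mul_le_mul_right _ hq
    rw [digitSum_add_mul hq hr, digitSum_add_mul hq ht]
    by_cases hrt : r + t < q
    · have h1 : r + q * a' + (t + q * b') = (r + t) + q * (a' + b') := by ring
      rw [h1, digitSum_add_mul hq hrt]
      rcases Nat.eq_zero_or_pos (a' + b') with h0 | h0
      · obtain ⟨rfl, rfl⟩ : a' = 0 ∧ b' = 0 := by omega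
        simp [digitSum_zero]
      · have := ih (a' + b') (by nlinarith) a' b' rfl
        omega
    · obtain ⟨w, hw⟩ : ∃ w, r + t = w + q := ⟨r + t - q, by omega⟩
      have h1 : r + q * a' + (t + q * b') = w + q * (a' + b' + 1) := by
        linear_combination hw
      have h2 : a' + b' + 1 < r + q * a' + (t + q * b') := by nlinarith
      have h3 := ih _ h2 (a' + b') 1 rfl
      have h4 := ih (a' + b') (by omega) a' b' rfl
      rw [h1, digitSum_add_mul hq (by omega)]
      rw [digitSum_of_lt (r := 1) hq (by omega)] at h3
      omega

theorem digitSum_sum_le {q : ℕ} (hq : 2 ≤ q) {ι : Type*} (s : Finset ι) (f : ι → ℕ) :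
    digitSum q (∑ i ∈ s, f i) ≤ ∑ i ∈ s, digitSum q (f i) :=
  Finset.le_sum_of_subadditive _ (digitSum_zero q).le (digitSum_add_le hq) _ _

theorem digitSum_le_self {q : ℕ} (a : ℕ) : digitSum q a ≤ a := Nat.digit_sum_le q a

theorem digitSum_smul_le {q : ℕ} (hq : 2 ≤ q) (r b : ℕ) :
    digitSum q (r * b) ≤ r * digitSum q b := by
  simpa using digitSum_sum_le hq (Finset.range r) (fun _ => b)

theorem digitSum_mul_le {q : ℕ} (hq : 2 ≤ q) (a b : ℕ) :
    digitSum q (a * b) ≤ digitSum q a * digitSum q b := by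
  induction a using Nat.strong_induction_on with
  | _ a ih =>
    rcases Nat.eq_zero_or_pos a with rfl | ha
    · simp [digitSum_zero]
    have h1 : a * b = (a % q) * b + q * ((a / q) * b) := by
      conv_lhs => rw [← Nat.mod_add_div a q]
      ring
    have h2 : digitSum q a = a % q + digitSum q (a / q) := by
      conv_lhs => rw [← Nat.mod_add_div a q]
      exact digitSum_add_mul hq (Nat.mod_lt _ (by omega)) _
    calc digitSum q (a * b)
        ≤ digitSum q ((a % q) * b) + digitSum q (q * ((a / q) * b)) := by
          rw [h1]; exact digitSum_add_le hq _ _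
      _ ≤ (a % q) * digitSum q b + digitSum q (a / q) * digitSum q b := by
          rw [digitSum_mul_base hq]
          exact Nat.add_le_add (digitSum_smul_le hq _ _) (ih _ (Nat.div_lt_self ha hq))
      _ = digitSum q a * digitSum q b := by rw [h2]; ring

theorem digitSum_pow_le {q : ℕ} (hq : 2 ≤ q) (a k : ℕ) :
    digitSum q (a ^ k) ≤ digitSum q a ^ k := by
  induction k with
  | zero => simpa using digitSum_le_self 1
  | succ k ih =>
    rw [pow_succ, pow_succ]
    exact (digitSum_mul_le hq _ _).trans (Nat.mul_le_mul_right _ ih)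

theorem digitSum_base_pow {q : ℕ} (hq : 2 ≤ q) (k : ℕ) : digitSum q (q ^ k) = 1 := by
  have := digitSum_add_mul_pow hq k 0 1 (by positivity)
  simpa [digitSum_zero, digitSum_of_lt (r := 1) hq (by omega)] using this

theorem digitSum_le_mul_log {q : ℕ} (hq : 2 ≤ q) (m : ℕ) :
    digitSum q m ≤ (q - 1) * (Nat.log q m + 1) := by
  rcases Nat.eq_zero_or_pos m with rfl | hm
  · simp [digitSum_zero]
  have h := List.sum_le_card_nsmul (q.digits m) (q - 1) (fun x hx => by
    have := Nat.digits_lt_base hq hx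
    omega)
  rw [Nat.length_digits q m hq hm.ne'] at h
  rw [digitSum]
  simpa [mul_comm] using h

theorem digitSum_sum_mul_pow {q : ℕ} (hq : 2 ≤ q) (u T : ℕ) (c : ℕ → ℕ)
    (hc : ∀ t, c t < q ^ u) :
    digitSum q (∑ t ∈ Finset.range T, c t * (q ^ u) ^ t) =
      ∑ t ∈ Finset.range T, digitSum q (c t) := by
  induction T generalizing c with
  | zero => simp [digitSum_zero]
  | succ T ih =>
    have h : ∑ t ∈ Finset.range (T + 1), c t * (q ^ u) ^ t =
        c 0 + q ^ u * ∑ t ∈ Finset.range T, c (t + 1) * (q ^ u) ^ t := by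
      rw [Finset.sum_range_succ', Finset.mul_sum, add_comm]
      congr 1
      · simp
      · exact Finset.sum_congr rfl fun t _ => by ring
    rw [h, digitSum_add_mul_pow hq _ _ _ (hc 0), ih (fun t => c (t + 1)) (fun t => hc _),
      Finset.sum_range_succ', add_comm]

/-! ### Bose–Chowla exponents and sums of powers without carries. -/

open Polynomial in
/-- A Bose–Chowla set: sums of at most `h` of the `d a` have boundedly many representations. -/
theorem exists_boseChowla (l h : ℕ) [Fact l.Prime] (hh : 2 ≤ h) :
    ∃ d : ZMod l → ℕ, (∀ a, d a < l ^ h) ∧ ∀ j ≤ h, ∀ t : ℕ,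
      (Finset.univ.filter fun f : Fin j → ZMod l => ∑ i, d (f i) = t).card ≤ h ^ h := by
  classical
  let F := ZMod l
  let K := GaloisField l h
  have hh0 : h ≠ 0 := by omega
  have : Finite K := inferInstance
  have := Fintype.ofFinite K
  have hcard : Nat.card K = l ^ h := GaloisField.card l h hh0
  obtain ⟨θ, hθ⟩ := Field.exists_primitive_element F K
  have hdeg : (minpoly F θ).natDegree = h := by
    rw [(Field.primitive_element_iff_minpoly_natDegree_eq F θ).1 hθ]
    exact GaloisField.finrank l hh0
  -- θ has degree h over the prime field. The exponents d a will be discrete logarithms of θ + a.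
  have key : ∀ P : F[X], P.degree < h → aeval θ P = 0 → P = 0 := by
    intro P hP h0
    by_contra hne
    have h1 := minpoly.degree_le_of_ne_zero F θ hne h0
    rw [degree_eq_natDegree (minpoly.ne_zero (Algebra.IsIntegral.isIntegral θ)), hdeg] at h1
    exact absurd hP h1.not_gt
  have hne : ∀ a : F, θ + algebraMap F K a ≠ 0 := by
    intro a h0
    refine X_add_C_ne_zero a (key _ ?_ (by simpa using h0))
    rw [degree_X_add_C]
    exact_mod_cast (by omega : 1 < h)
  obtain ⟨g, hg⟩ := IsCyclic.exists_generator (α := Kˣ)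
  have hlog : ∀ a : F, ∃ k : ℕ, k < l ^ h ∧ ((g ^ k : Kˣ) : K) = θ + algebraMap F K a := by
    intro a
    obtain ⟨k, hk⟩ := mem_powers_iff_mem_zpowers.2 (hg (Units.mk0 _ (hne a)))
    refine ⟨k % orderOf g, ?_, ?_⟩
    · calc k % orderOf g < orderOf g := Nat.mod_lt _ (orderOf_pos g)
        _ ≤ Nat.card Kˣ := orderOf_le_card
        _ ≤ Nat.card K := Nat.card_le_card_of_injective _ Units.val_injective
        _ = l ^ h := hcard
    · rw [pow_mod_orderOf]
      have := congrArg Units.val hk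
      simpa using this
  choose d hd hgd using hlog
  refine ⟨d, hd, fun j hj t => ?_⟩
  -- Equal exponent sums give equal values at θ of two monic polynomials of degree j ≤ h. Their
  -- difference has degree below h, so they coincide, and every -f i is one of at most h roots.
  let P : (Fin j → F) → F[X] := fun f => ∏ i, (X + C (f i))
  have hmonic : ∀ f, (P f).Monic := fun f => monic_prod_of_monic _ _ fun i _ => monic_X_add_C _
  have hPdeg : ∀ f, (P f).natDegree = j := fun f => by
    simp [P, natDegree_prod_of_monic _ _ fun i _ => monic_X_add_C (f i)]
  have hPeval : ∀ f, aeval θ (P f) = ((g ^ (∑ i, d (f i)) : Kˣ) : K) := fun f => by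
    simp only [P, map_prod, map_add, aeval_X, aeval_C, ← Finset.prod_pow_eq_pow_sum,
      Units.coe_prod, hgd]
  rcases Finset.eq_empty_or_nonempty
    (Finset.univ.filter fun f : Fin j → ZMod l => ∑ i, d (f i) = t) with he | ⟨f₀, hf₀⟩
  · simp [he]
  have hsub : (Finset.univ.filter fun f : Fin j → ZMod l => ∑ i, d (f i) = t) ⊆
      Fintype.piFinset fun _ : Fin j => (P f₀).roots.toFinset.image fun x => -x := by
    intro f hf
    have hf1 : ∑ i, d (f i) = ∑ i, d (f₀ i) := by
      rw [(Finset.mem_filter.1 hf).2, (Finset.mem_filter.1 hf₀).2]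
    have heq : P f = P f₀ := by
      refine sub_eq_zero.1 (key _ ?_ ?_)
      · refine (degree_sub_lt_left ?_ (hmonic f).ne_zero ?_).trans_le ?_
        · rw [degree_eq_natDegree (hmonic f).ne_zero, degree_eq_natDegree (hmonic f₀).ne_zero,
            hPdeg, hPdeg]
        · rw [(hmonic f).leadingCoeff, (hmonic f₀).leadingCoeff]
        · rw [degree_eq_natDegree (hmonic f).ne_zero, hPdeg]
          exact_mod_cast hj
      · rw [map_sub, hPeval, hPeval, hf1, sub_self]
    refine Fintype.mem_piFinset.2 fun i => Finset.mem_image.2 ⟨-f i, ?_, neg_neg _⟩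
    rw [Multiset.mem_toFinset, mem_roots (hmonic f₀).ne_zero, ← heq, IsRoot.def, eval_prod]
    exact Finset.prod_eq_zero (Finset.mem_univ i) (by simp)
  refine (Finset.card_le_card hsub).trans ?_
  rw [Fintype.card_piFinset]
  calc ∏ _i : Fin j, ((P f₀).roots.toFinset.image fun x => -x).card
      ≤ ∏ _i : Fin j, h := Finset.prod_le_prod' fun i _ =>
        Finset.card_image_le.trans ((Multiset.toFinset_card_le _).trans
          ((card_roots' _).trans ((hPdeg f₀).trans_le hj)))
    _ = h ^ j := by simp
    _ ≤ h ^ h := Nat.pow_le_pow_right (by omega) hj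

/-- Expanding the powers, the coefficient of (q^u)^t is a weighted count of representations of t,
below q^u by `hu`, so nothing carries. Each t that is a sum of h exponents accounts for at most R
tuples and contributes at least 1 to the digit sum. -/
theorem card_pow_le_mul_digitSum {q : ℕ} (hq : 2 ≤ q) {ι : Type*} [Fintype ι] (d : ι → ℕ)
    (a : ℕ → ℕ) (h u R : ℕ) (ha : 0 < a h)
    (hR : ∀ j ≤ h, ∀ t, (Finset.univ.filter fun f : Fin j → ι => ∑ i, d (f i) = t).card ≤ R)
    (hu : (∑ j ∈ Finset.range (h + 1), a j) * R < q ^ u) :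
    Fintype.card ι ^ h ≤
      R * digitSum q (∑ j ∈ Finset.range (h + 1), a j * (∑ x, (q ^ u) ^ d x) ^ j) := by
  classical
  let r : ℕ → ℕ → ℕ := fun j t =>
    (Finset.univ.filter fun f : Fin j → ι => ∑ i, d (f i) = t).card
  let T := h * (∑ x, d x) + 1
  -- By `hR` the minimum changes nothing; it makes c t < q^u immediate.
  let c : ℕ → ℕ := fun t => ∑ j ∈ Finset.range (h + 1), a j * min (r j t) R
  have hmem : ∀ j ≤ h, ∀ f ∈ (Finset.univ : Finset (Fin j → ι)),
      ∑ i, d (f i) ∈ Finset.range T := by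
    intro j hj f _
    have h1 : ∑ i, d (f i) ≤ ∑ _i : Fin j, ∑ x, d x :=
      Finset.sum_le_sum fun i _ => Finset.single_le_sum (f := d) (fun _ _ => Nat.zero_le _)
        (Finset.mem_univ (f i))
    have h2 : j * ∑ x, d x ≤ h * ∑ x, d x := Nat.mul_le_mul_right _ hj
    simp only [Finset.sum_const, Finset.card_univ, Fintype.card_fin, smul_eq_mul] at h1
    exact Finset.mem_range.2 (by omega)
  have hpow : ∀ j ≤ h, (∑ x, (q ^ u) ^ d x) ^ j =
      ∑ t ∈ Finset.range T, r j t * (q ^ u) ^ t := by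
    intro j hj
    rw [Fintype.sum_pow, ← Finset.sum_fiberwise_of_maps_to (hmem j hj)]
    refine Finset.sum_congr rfl fun t _ => ?_
    rw [Finset.sum_congr rfl (g := fun _ => (q ^ u) ^ t), Finset.sum_const, smul_eq_mul]
    intro f hf
    rw [Finset.prod_pow_eq_pow_sum, (Finset.mem_filter.1 hf).2]
  have hsum : ∑ j ∈ Finset.range (h + 1), a j * (∑ x, (q ^ u) ^ d x) ^ j =
      ∑ t ∈ Finset.range T, c t * (q ^ u) ^ t := by
    simp only [c, Finset.sum_mul]
    rw [Finset.sum_comm]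
    refine Finset.sum_congr rfl fun j hj => ?_
    have hj' : j ≤ h := Nat.lt_succ_iff.1 (Finset.mem_range.1 hj)
    rw [hpow j hj', Finset.mul_sum]
    refine Finset.sum_congr rfl fun t _ => ?_
    rw [min_eq_left (hR j hj' t), mul_assoc]
  have hc : ∀ t, c t < q ^ u := fun t => by
    refine lt_of_le_of_lt ?_ hu
    rw [Finset.sum_mul]
    exact Finset.sum_le_sum fun j _ => Nat.mul_le_mul_left _ (min_le_right _ _)
  rw [hsum, digitSum_sum_mul_pow hq u T c hc, Finset.mul_sum]
  have hcard : Fintype.card ι ^ h = ∑ t ∈ Finset.range T, r h t := by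
    rw [← Finset.card_eq_sum_card_fiberwise (hmem h le_rfl)]
    simp
  rw [hcard]
  refine Finset.sum_le_sum fun t _ => ?_
  have hr : r h t ≤ R := hR h le_rfl t
  rcases Nat.eq_zero_or_pos (r h t) with h0 | h0
  · omega
  · have h1 : 0 < a h * min (r h t) R := Nat.mul_pos ha (lt_min h0 (h0.trans_le hr))
    have h2 : a h * min (r h t) R ≤ c t :=
      Finset.single_le_sum (f := fun j => a j * min (r j t) R) (fun _ _ => Nat.zero_le _)
        (Finset.mem_range.2 (Nat.lt_succ_self h))
    exact hr.trans (Nat.le_mul_of_pos_right _ (digitSum_pos hq (h1.trans_le h2)))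

/-! ### Digit sums of polynomial values; nonnegative coefficients. -/

theorem toNat_eval_eq_sum {p : Polynomial ℤ} (hp : ∀ i, 0 ≤ p.coeff i) (n : ℕ) :
    (p.eval (n : ℤ)).toNat =
      ∑ j ∈ Finset.range (p.natDegree + 1), (p.coeff j).toNat * n ^ j := by
  have : p.eval (n : ℤ) =
      ((∑ j ∈ Finset.range (p.natDegree + 1), (p.coeff j).toNat * n ^ j : ℕ) : ℤ) := by
    rw [Polynomial.eval_eq_sum_range]
    push_cast
    exact Finset.sum_congr rfl fun j _ => by rw [Int.toNat_of_nonneg (hp j)]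
  rw [this, Int.toNat_natCast]

theorem digitSum_eval_le_mul_pow {p : Polynomial ℤ} (hp : ∀ i, 0 ≤ p.coeff i) {q : ℕ}
    (hq : 2 ≤ q) {n : ℕ} (hn : 0 < n) :
    digitSum q (p.eval (n : ℤ)).toNat ≤
      (∑ j ∈ Finset.range (p.natDegree + 1), (p.coeff j).toNat) *
        digitSum q n ^ p.natDegree := by
  rw [toNat_eval_eq_sum hp, Finset.sum_mul]
  refine (digitSum_sum_le hq _ _).trans (Finset.sum_le_sum fun j hj => ?_)
  refine (digitSum_smul_le hq _ _).trans (Nat.mul_le_mul_left _ ?_)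
  exact (digitSum_pow_le hq n j).trans
    (Nat.pow_le_pow_right (digitSum_pos hq hn) (Nat.lt_succ_iff.1 (Finset.mem_range.1 hj)))

theorem logb_natCast_pos {q n : ℕ} (hq : 2 ≤ q) (hn : 2 ≤ n) : 0 < Real.logb q n :=
  Real.logb_pos (by exact_mod_cast hq) (by exact_mod_cast hn)

theorem exists_digitSum_eval_le_logb (p : Polynomial ℤ) {q : ℕ} (hq : 2 ≤ q) :
    ∃ B : ℝ, 0 < B ∧ ∀ n : ℕ, 2 ≤ n →
      (digitSum q (p.eval (n : ℤ)).toNat : ℝ) ≤ B * Real.logb q n := by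
  set h := p.natDegree
  let S : ℕ := ∑ j ∈ Finset.range (h + 1), (p.coeff j).natAbs
  have hq1 : (1 : ℝ) < q := by exact_mod_cast hq
  have hL2 : 0 < Real.logb q 2 := by exact_mod_cast logb_natCast_pos hq le_rfl
  have hLS : 0 ≤ Real.logb q ((S + 1 : ℕ) : ℝ) :=
    Real.logb_nonneg hq1 (by exact_mod_cast Nat.succ_pos S)
  -- Since n ≥ 2, D absorbs the additive constant into a multiple of log_q n.
  set D := (Real.logb q ((S + 1 : ℕ) : ℝ) + 1) / Real.logb q 2 with hD
  have hD0 : 0 < D := by positivity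
  refine ⟨(q - 1) * (h + D), mul_pos (by linarith) (by positivity), fun n hn => ?_⟩
  have hle : (p.eval (n : ℤ)).toNat ≤ (S + 1) * n ^ h := by
    rw [Int.toNat_le, Polynomial.eval_eq_sum_range]
    calc ∑ j ∈ Finset.range (h + 1), p.coeff j * (n : ℤ) ^ j
        ≤ ∑ j ∈ Finset.range (h + 1), ((p.coeff j).natAbs : ℤ) * (n : ℤ) ^ h := by
          refine Finset.sum_le_sum fun j hj => ?_
          have h1 : (n : ℤ) ^ j ≤ (n : ℤ) ^ h :=
            pow_le_pow_right₀ (by omega) (Nat.lt_succ_iff.1 (Finset.mem_range.1 hj))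
          exact mul_le_mul Int.le_natAbs h1 (by positivity) (by positivity)
      _ = (S : ℤ) * (n : ℤ) ^ h := by rw [← Finset.sum_mul]; push_cast [S]; rfl
      _ ≤ (((S + 1) * n ^ h : ℕ) : ℤ) := by
          push_cast
          exact mul_le_mul_of_nonneg_right (by omega) (by positivity)
  have hlog : (Nat.log q (p.eval (n : ℤ)).toNat : ℝ) ≤
      Real.logb q ((S + 1 : ℕ) : ℝ) + h * Real.logb q n := by
    have hn0 : (n : ℝ) ≠ 0 := by positivity
    calc (Nat.log q (p.eval (n : ℤ)).toNat : ℝ)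
        ≤ (Nat.log q ((S + 1) * n ^ h) : ℝ) := by exact_mod_cast Nat.log_mono_right hle
      _ ≤ Real.logb q (((S + 1) * n ^ h : ℕ) : ℝ) := Real.natLog_le_logb _ _
      _ = _ := by
          rw [Nat.cast_mul, Real.logb_mul (by positivity) (by positivity), Nat.cast_pow,
            Real.logb_pow]
  have hmono : Real.logb q 2 ≤ Real.logb q n :=
    Real.logb_le_logb_of_le hq1 (by norm_num) (by exact_mod_cast hn)
  have hDn : Real.logb q ((S + 1 : ℕ) : ℝ) + 1 ≤ D * Real.logb q n :=
    calc Real.logb q ((S + 1 : ℕ) : ℝ) + 1 = D * Real.logb q 2 := by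
          rw [hD, div_mul_cancel₀ _ hL2.ne']
      _ ≤ _ := mul_le_mul_of_nonneg_left hmono hD0.le
  calc (digitSum q (p.eval (n : ℤ)).toNat : ℝ)
      ≤ (((q - 1) * (Nat.log q (p.eval (n : ℤ)).toNat + 1) : ℕ) : ℝ) := by
        exact_mod_cast digitSum_le_mul_log hq _
    _ = ((q : ℝ) - 1) * (Nat.log q (p.eval (n : ℤ)).toNat + 1) := by
        push_cast [Nat.cast_sub (show 1 ≤ q by omega)]
        ring
    _ ≤ ((q : ℝ) - 1) * ((h + D) * Real.logb q n) :=
        mul_le_mul_of_nonneg_left (by linarith) (by linarith)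
    _ = _ := by ring

theorem pow_pred_rpow {x : ℝ} (hx : 0 ≤ x) {h : ℕ} (hh : 1 ≤ h) :
    (x ^ (h - 1)) ^ ((h : ℝ)⁻¹) = x ^ (1 - 1 / (h : ℝ)) := by
  have : (h : ℝ) ≠ 0 := by positivity
  rw [← Real.rpow_natCast, ← Real.rpow_mul hx, Nat.cast_sub hh]
  congr 1
  field_simp
  simp

theorem digitRatio_le_of_coeff_nonneg {p : Polynomial ℤ} (hdeg : 2 ≤ p.natDegree)
    (hp : ∀ i, 0 ≤ p.coeff i) {q : ℕ} (hq : 2 ≤ q) :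
    ∃ c : ℝ, 0 < c ∧ ∀ n : ℕ, 2 ≤ n →
      digitRatio p q n ≤ c * Real.logb (q : ℝ) (n : ℝ) ^ (1 - 1 / (p.natDegree : ℝ)) := by
  obtain ⟨B, hB, hXB⟩ := exists_digitSum_eval_le_logb p hq
  set h := p.natDegree with hh
  set A : ℕ := ∑ j ∈ Finset.range (h + 1), (p.coeff j).toNat
  refine ⟨(((A : ℝ) + 1) * B ^ (h - 1)) ^ ((h : ℝ)⁻¹), by positivity, fun n hn => ?_⟩
  have hL := logb_natCast_pos hq hn
  set L := Real.logb q n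
  have hXB := hXB n hn
  have hXA : (digitSum q (p.eval (n : ℤ)).toNat : ℝ) ≤ (A + 1) * (digitSum q n : ℝ) ^ h := by
    have h1 : (digitSum q (p.eval (n : ℤ)).toNat : ℝ) ≤ A * (digitSum q n : ℝ) ^ h := by
      exact_mod_cast digitSum_eval_le_mul_pow hp hq (show 0 < n by omega)
    refine h1.trans (mul_le_mul_of_nonneg_right (by linarith) (by positivity))
  have hs : (0 : ℝ) < digitSum q n := by exact_mod_cast digitSum_pos hq (show 0 < n by omega)
  rw [digitRatio]
  set X : ℝ := (digitSum q (p.eval (n : ℤ)).toNat : ℝ)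
  set s : ℝ := (digitSum q n : ℝ)
  have hX : 0 ≤ X := Nat.cast_nonneg _
  -- One factor X is bounded by the power of s, the other h - 1 by the logarithm, so s cancels.
  have hpow : (X / s) ^ h ≤ ((A : ℝ) + 1) * B ^ (h - 1) * L ^ (h - 1) := by
    rw [div_pow, div_le_iff₀ (by positivity)]
    calc X ^ h = X * X ^ (h - 1) := by rw [← pow_succ']; congr 1; omega
      _ ≤ ((A + 1) * s ^ h) * (B * L) ^ (h - 1) :=
          mul_le_mul hXA (pow_le_pow_left₀ hX hXB _) (by positivity) (by positivity)
      _ = _ := by rw [mul_pow]; ring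
  calc X / s = ((X / s) ^ h) ^ ((h : ℝ)⁻¹) :=
        (Real.pow_rpow_inv_natCast (by positivity) (by omega)).symm
    _ ≤ (((A : ℝ) + 1) * B ^ (h - 1) * L ^ (h - 1)) ^ ((h : ℝ)⁻¹) :=
        Real.rpow_le_rpow (by positivity) hpow (by positivity)
    _ = _ := by rw [Real.mul_rpow (by positivity) (by positivity), pow_pred_rpow hL.le (by omega)]

theorem frequently_lt_digitRatio_of_coeff_nonneg {p : Polynomial ℤ} (hdeg : 2 ≤ p.natDegree)
    (hlead : 0 < p.leadingCoeff) (hp : ∀ i, 0 ≤ p.coeff i) :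
    ∃ c : ℝ, 0 < c ∧ ∀ q : ℕ, 2 ≤ q → ∃ᶠ n : ℕ in atTop,
      digitRatio p q n > c * Real.logb (q : ℝ) (n : ℝ) ^ (1 - 1 / (p.natDegree : ℝ)) := by
  set h := p.natDegree with hh
  let a : ℕ → ℕ := fun j => (p.coeff j).toNat
  have ha : 0 < a h := by
    have : 0 < p.coeff h := hlead
    simp only [a]
    omega
  -- As u < 2^u ≤ q^u, this choice prevents carries in every base at once; hence the constant is
  -- independent of q.
  set u : ℕ := (∑ j ∈ Finset.range (h + 1), a j) * h ^ h with hu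
  have hu0 : 0 < u := by
    refine Nat.mul_pos (ha.trans_le ?_) (by positivity)
    exact Finset.single_le_sum (f := a) (fun _ _ => Nat.zero_le _) (by simp)
  refine ⟨1 / ((h : ℝ) ^ h * (4 * u)), by positivity, fun q hq => ?_⟩
  rw [frequently_atTop]
  intro N
  obtain ⟨l, hlN, hl⟩ := Nat.exists_infinite_primes N
  have : Fact l.Prime := ⟨hl⟩
  obtain ⟨d, hd, hrep⟩ := exists_boseChowla l h hdeg
  have hqu : u < q ^ u := Nat.lt_two_pow_self.trans_le (Nat.pow_le_pow_left hq u)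
  have hQ : 2 ≤ q ^ u := by omega
  let n := ∑ x, (q ^ u) ^ d x
  have hnl : l ≤ n := by
    calc l = ∑ _x : ZMod l, 1 := by simp [ZMod.card]
      _ ≤ n := Finset.sum_le_sum fun x _ => Nat.one_le_pow _ _ (by omega)
  refine ⟨n, hlN.trans hnl, ?_⟩
  have hX : l ^ h ≤ h ^ h * digitSum q (p.eval (n : ℤ)).toNat := by
    rw [toNat_eval_eq_sum hp]
    simpa [ZMod.card] using card_pow_le_mul_digitSum hq d a h u (h ^ h) ha hrep hqu
  have hs : digitSum q n ≤ l := by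
    refine (digitSum_sum_le hq _ _).trans ?_
    simp [← pow_mul, digitSum_base_pow hq, ZMod.card]
  have hn0 : 0 < n := hl.pos.trans_le hnl
  have hs0 : 0 < digitSum q n := digitSum_pos hq hn0
  have hnle : n ≤ q ^ (2 * u * l ^ h) := by
    calc n ≤ ∑ _x : ZMod l, (q ^ u) ^ (l ^ h) :=
          Finset.sum_le_sum fun x _ => Nat.pow_le_pow_right (by omega) (hd x).le
      _ = l * (q ^ u) ^ (l ^ h) := by simp [ZMod.card]
      _ ≤ (q ^ u) ^ (l ^ h) * (q ^ u) ^ (l ^ h) := by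
          refine Nat.mul_le_mul_right _ ?_
          calc l ≤ l ^ h := Nat.le_self_pow (by omega) l
            _ ≤ 2 ^ (l ^ h) := Nat.lt_two_pow_self.le
            _ ≤ _ := Nat.pow_le_pow_left hQ _
      _ = q ^ (2 * u * l ^ h) := by rw [← pow_add, ← pow_mul]; congr 1; ring
  have hq1 : (1 : ℝ) < q := by exact_mod_cast hq
  have hL0 : 0 ≤ Real.logb q n := Real.logb_nonneg hq1 (by exact_mod_cast hn0)
  have hL : Real.logb q n ≤ 2 * u * (l : ℝ) ^ h := by
    calc Real.logb q n ≤ Real.logb q ((q : ℝ) ^ (2 * u * l ^ h)) :=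
          Real.logb_le_logb_of_le hq1 (by exact_mod_cast hn0) (by exact_mod_cast hnle)
      _ = _ := by
          rw [Real.logb_pow, Real.logb_self_eq_one hq1]
          push_cast
          ring
  have hl0 : (0 : ℝ) < l := by exact_mod_cast hl.pos
  have hu1 : (1 : ℝ) ≤ 2 * u := by
    have : (1 : ℝ) ≤ u := by exact_mod_cast hu0
    linarith
  have hexp : 0 ≤ 1 - 1 / (h : ℝ) := by
    rw [sub_nonneg, div_le_one (by positivity)]
    exact_mod_cast (by omega : 1 ≤ h)
  have hLpow : Real.logb q n ^ (1 - 1 / (h : ℝ)) ≤ 2 * u * (l : ℝ) ^ (h - 1) := by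
    calc Real.logb q n ^ (1 - 1 / (h : ℝ)) ≤ (2 * u * (l : ℝ) ^ h) ^ (1 - 1 / (h : ℝ)) :=
          Real.rpow_le_rpow hL0 hL hexp
      _ = (2 * u : ℝ) ^ (1 - 1 / (h : ℝ)) * (l : ℝ) ^ (h - 1) := by
          rw [Real.mul_rpow (by positivity) (by positivity), ← pow_pred_rpow (by positivity)
            (show 1 ≤ h by omega), ← pow_pred_rpow (x := (l : ℝ) ^ h) (by positivity)
            (show 1 ≤ h by omega), ← pow_mul, mul_comm h, pow_mul,
            Real.pow_rpow_inv_natCast (by positivity) (by omega)]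
      _ ≤ _ := by
          refine mul_le_mul_of_nonneg_right ?_ (by positivity)
          exact Real.rpow_le_self_of_one_le hu1 (by simp)
  have hXr : (l : ℝ) ^ h ≤ (h : ℝ) ^ h * digitSum q (p.eval (n : ℤ)).toNat := by
    exact_mod_cast hX
  have hsr : (digitSum q n : ℝ) ≤ l := by exact_mod_cast hs
  have hs0r : (0 : ℝ) < digitSum q n := by exact_mod_cast hs0
  have hu0r : (0 : ℝ) < u := by exact_mod_cast hu0
  have hhh : (0 : ℝ) < (h : ℝ) ^ h := by positivity
  rw [gt_iff_lt, digitRatio]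
  calc 1 / ((h : ℝ) ^ h * (4 * u)) * Real.logb q n ^ (1 - 1 / (h : ℝ))
      ≤ 1 / ((h : ℝ) ^ h * (4 * u)) * (2 * u * (l : ℝ) ^ (h - 1)) :=
        mul_le_mul_of_nonneg_left hLpow (by positivity)
    _ = (l : ℝ) ^ (h - 1) / (h : ℝ) ^ h / 2 := by
        field_simp
        norm_num
    _ < (l : ℝ) ^ (h - 1) / (h : ℝ) ^ h := half_lt_self (by positivity)
    _ = (l : ℝ) ^ h / (h : ℝ) ^ h / l := by
        have : (l : ℝ) ^ h = (l : ℝ) ^ (h - 1) * l := by rw [← pow_succ]; congr 1; omega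
        rw [this]
        field_simp
    _ ≤ (digitSum q (p.eval (n : ℤ)).toNat : ℝ) / l := by
        refine div_le_div_of_nonneg_right ?_ hl0.le
        rw [div_le_iff₀ hhh]
        linarith
    _ ≤ _ := div_le_div_of_nonneg_left (by positivity) hs0r hsr

/-! ### Dominant terms and borrowing; negative coefficients. -/

theorem abs_sum_mul_pow_lt (a : ℕ → ℤ) (m : ℕ) {x : ℤ}
    (hx : ∑ i ∈ Finset.range m, |a i| < x) :
    |∑ i ∈ Finset.range m, a i * x ^ i| < x ^ m := by
  have hx0 : 0 < x := (Finset.sum_nonneg fun _ _ => abs_nonneg _).trans_lt hx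
  refine lt_of_mul_lt_mul_left (a := x) ?_ hx0.le
  calc x * |∑ i ∈ Finset.range m, a i * x ^ i|
      ≤ x * ∑ i ∈ Finset.range m, |a i * x ^ i| :=
        mul_le_mul_of_nonneg_left (Finset.abs_sum_le_sum_abs _ _) hx0.le
    _ = ∑ i ∈ Finset.range m, |a i| * x ^ (i + 1) := by
        rw [Finset.mul_sum]
        refine Finset.sum_congr rfl fun i _ => ?_
        rw [abs_mul, abs_of_nonneg (pow_nonneg hx0.le i)]
        ring
    _ ≤ ∑ i ∈ Finset.range m, |a i| * x ^ m :=
        Finset.sum_le_sum fun i hi => mul_le_mul_of_nonneg_left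
          (pow_le_pow_right₀ hx0 (Finset.mem_range.1 hi)) (abs_nonneg _)
    _ = (∑ i ∈ Finset.range m, |a i|) * x ^ m := (Finset.sum_mul _ _ _).symm
    _ < x * x ^ m := mul_lt_mul_of_pos_right hx (pow_pos hx0 m)

theorem sum_mul_pow_pos (a : ℕ → ℤ) (m : ℕ) (ha : 0 < a m) {x : ℤ}
    (hx : ∑ i ∈ Finset.range m, |a i| < x) :
    0 < ∑ i ∈ Finset.range (m + 1), a i * x ^ i := by
  have hx0 : 0 < x := (Finset.sum_nonneg fun _ _ => abs_nonneg _).trans_lt hx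
  have h1 := (abs_lt.1 (abs_sum_mul_pow_lt a m hx)).1
  have h2 : 1 * x ^ m ≤ a m * x ^ m := mul_le_mul_of_nonneg_right ha (pow_pos hx0 m).le
  rw [Finset.sum_range_succ]
  linarith

theorem mul_le_digitSum_sub {q : ℕ} (hq : 2 ≤ q) (e c N W : ℕ) (hW : 0 < W) (hWe : W ≤ q ^ e) :
    (q - 1) * c ≤ digitSum q (q ^ (e + c) * (N + 1) - W) := by
  have hc : 0 < q ^ c := by positivity
  obtain ⟨y, hy⟩ : ∃ y, q ^ c = y + 1 := ⟨q ^ c - 1, by omega⟩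
  -- Borrowing one unit of q^(e+c) leaves c digits q - 1 just above the lowest e places.
  have h1 : q ^ (e + c) * (N + 1) - W =
      (q ^ e - W) + q ^ e * ((q ^ c - 1) + q ^ c * N) := by
    have : q ^ (e + c) * (N + 1) = q ^ e + q ^ e * ((q ^ c - 1) + q ^ c * N) := by
      rw [pow_add, hy, Nat.add_sub_cancel]
      ring
    omega
  rw [h1, digitSum_add_mul_pow hq _ _ _ (by omega), digitSum_add_mul_pow hq _ _ _ (by omega),
    digitSum_pow_sub_one hq]
  omega

theorem exists_mul_le_digitSum_eval_pow {p : Polynomial ℤ} (hlead : 0 < p.leadingCoeff)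
    {i : ℕ} (hi : p.coeff i < 0) {q : ℕ} (hq : 2 ≤ q) :
    ∃ b : ℕ, ∀ k ≥ b, (q - 1) * (k - b) ≤ digitSum q (p.eval ((q ^ k : ℕ) : ℤ)).toNat := by
  have hih : i < p.natDegree := by
    refine lt_of_le_of_ne (Polynomial.le_natDegree_of_ne_zero hi.ne) ?_
    rintro rfl
    exact absurd hlead hi.not_gt
  obtain ⟨m, hm⟩ : ∃ m, p.natDegree = i + 1 + m := ⟨p.natDegree - (i + 1), by omega⟩
  let A : ℕ := ∑ j ∈ Finset.range (p.natDegree + 1), (p.coeff j).natAbs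
  have hsub : ∀ s ⊆ Finset.range (p.natDegree + 1), ∑ j ∈ s, |p.coeff j| ≤ (A : ℤ) := by
    intro s hs
    push_cast [A]
    exact Finset.sum_le_sum_of_subset_of_nonneg hs fun _ _ _ => abs_nonneg _
  -- The A + 1 lost places cover the factor in W ≤ (A + 1) q^(ki), because A + 1 < q^(A+1).
  refine ⟨A + 1, fun k hk => ?_⟩
  let x : ℤ := ((q ^ k : ℕ) : ℤ)
  have hpow : ∀ b, b < q ^ b := fun b => Nat.lt_two_pow_self.trans_le (Nat.pow_le_pow_left hq b)
  have hAx : (A : ℤ) < x := by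
    have := hpow k
    simp only [x]
    omega
  have hx0 : 0 < x := by omega
  -- Cut just above the negative coefficient: for large x the low part R takes its sign, and the
  -- high part M that of the leading coefficient.
  set R := ∑ j ∈ Finset.range (i + 1), p.coeff j * x ^ j with hR
  set M := ∑ j ∈ Finset.range (m + 1), p.coeff (i + 1 + j) * x ^ j with hM
  have hp : p.eval x = x ^ (i + 1) * M + R := by
    rw [Polynomial.eval_eq_sum_range, hm, add_assoc (i + 1), Finset.sum_range_add, add_comm,
      hM, Finset.mul_sum]
    congr 1
    exact Finset.sum_congr rfl fun j _ => by ring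
  have hlow : |∑ j ∈ Finset.range i, p.coeff j * x ^ j| < x ^ i :=
    abs_sum_mul_pow_lt _ i (lt_of_le_of_lt
      (hsub _ (Finset.range_subset_range.2 (by omega))) hAx)
  have hRneg : R < 0 := by
    have := sum_mul_pow_pos (fun j => -p.coeff j) i (by simpa using hi) (x := x) (by
      simp only [abs_neg]
      exact lt_of_le_of_lt (hsub _ (Finset.range_subset_range.2 (by omega))) hAx)
    simp only [neg_mul, Finset.sum_neg_distrib] at this
    linarith
  have hRlow : -R ≤ (A + 1) * x ^ i := by
    have h1 := (abs_lt.1 hlow).1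
    have h2 : -p.coeff i ≤ A := (neg_le_abs _).trans (by
      simpa using hsub {i} (by simpa using (by omega : i < p.natDegree + 1)))
    have h3 := mul_le_mul_of_nonneg_right h2 (pow_pos hx0 i).le
    rw [hR, Finset.sum_range_succ]
    linarith
  have hMpos : 0 < M := by
    refine sum_mul_pow_pos (fun j => p.coeff (i + 1 + j)) m ?_ (lt_of_le_of_lt ?_ hAx)
    · rw [← hm]
      exact hlead
    · have h1 : ∑ j ∈ Finset.range m, |p.coeff (i + 1 + j)| =
          ∑ j ∈ (Finset.range m).map (addLeftEmbedding (i + 1)), |p.coeff j| := by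
        simp
      rw [h1]
      refine hsub _ fun j hj => ?_
      simp only [Finset.mem_map, Finset.mem_range, addLeftEmbedding_apply] at hj ⊢
      omega
  obtain ⟨W, hW⟩ : ∃ W : ℕ, -R = W := ⟨(-R).toNat, by omega⟩
  obtain ⟨N, hN⟩ : ∃ N : ℕ, M = ((N + 1 : ℕ) : ℤ) := ⟨(M - 1).toNat, by omega⟩
  have hWle : W ≤ q ^ (k * i + (A + 1)) := by
    have h1 : W ≤ (A + 1) * (q ^ k) ^ i := by
      rw [hW, show x = ((q ^ k : ℕ) : ℤ) from rfl] at hRlow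
      exact_mod_cast hRlow
    refine h1.trans ?_
    rw [pow_add, ← pow_mul, mul_comm]
    exact Nat.mul_le_mul_left _ (hpow _).le
  have hexp : k * i + (A + 1) + (k - (A + 1)) = k * (i + 1) := by
    rw [Nat.mul_add]
    omega
  have heval : (p.eval x).toNat = q ^ (k * i + (A + 1) + (k - (A + 1))) * (N + 1) - W := by
    have h1 : p.eval x = ((q ^ (k * (i + 1)) * (N + 1) : ℕ) : ℤ) - W := by
      rw [hp, hN, ← hW]
      push_cast [x]
      ring
    rw [h1, hexp]
    omega
  have := mul_le_digitSum_sub hq (k * i + (A + 1)) (k - (A + 1)) N W (by omega) hWle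
  rwa [← heval] at this

theorem eval_pos_of_sum_lt {p : Polynomial ℤ} (hlead : 0 < p.leadingCoeff) {x : ℤ}
    (hx : ∑ i ∈ Finset.range p.natDegree, |p.coeff i| < x) : 0 < p.eval x := by
  rw [Polynomial.eval_eq_sum_range]
  exact sum_mul_pow_pos _ _ hlead hx

theorem digitRatio_le_mul_logb {p : Polynomial ℤ} (hlead : 0 < p.leadingCoeff) {q : ℕ}
    (hq : 2 ≤ q) :
    ∃ c : ℝ, 0 < c ∧ ∃ n₀ : ℕ, ∀ n : ℕ, n₀ ≤ n → 0 < n ∧ 0 ≤ p.eval (n : ℤ) ∧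
      digitRatio p q n ≤ c * Real.logb (q : ℝ) (n : ℝ) := by
  obtain ⟨B, hB, hXB⟩ := exists_digitSum_eval_le_logb p hq
  refine ⟨B, hB, (∑ i ∈ Finset.range p.natDegree, |p.coeff i|).toNat + 2, fun n hn =>
    ⟨by omega, (eval_pos_of_sum_lt hlead (by omega)).le, ?_⟩⟩
  refine (div_le_self (Nat.cast_nonneg _) ?_).trans (hXB n (by omega))
  exact_mod_cast digitSum_pos hq (show 0 < n by omega)

theorem frequently_lt_digitRatio_of_coeff_neg {p : Polynomial ℤ} (hlead : 0 < p.leadingCoeff)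
    {i : ℕ} (hi : p.coeff i < 0) {q : ℕ} (hq : 2 ≤ q) {ε : ℝ} (hε : 0 < ε) :
    ∃ᶠ n : ℕ in atTop, 0 ≤ p.eval (n : ℤ) ∧
      digitRatio p q n > ((q : ℝ) - 1 - ε) * Real.logb (q : ℝ) (n : ℝ) := by
  obtain ⟨b, hb⟩ := exists_mul_le_digitSum_eval_pow hlead hi hq
  rw [frequently_atTop]
  intro N
  -- For k ≥ K the loss (q - 1) b is less than ε k.
  obtain ⟨K, hK⟩ := exists_nat_gt (((q : ℝ) - 1) * b / ε)
  let k := N + K + b + (∑ i ∈ Finset.range p.natDegree, |p.coeff i|).toNat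
  have hkq : k < q ^ k := Nat.lt_two_pow_self.trans_le (Nat.pow_le_pow_left hq k)
  have hq1 : (1 : ℝ) < q := by exact_mod_cast hq
  refine ⟨q ^ k, by omega, (eval_pos_of_sum_lt hlead (by omega)).le, ?_⟩
  have hbk : b ≤ k := by omega
  have hX : ((q : ℝ) - 1) * (k - b) ≤ digitSum q (p.eval ((q ^ k : ℕ) : ℤ)).toNat := by
    have h1 : (((q - 1) * (k - b) : ℕ) : ℝ) ≤ digitSum q (p.eval ((q ^ k : ℕ) : ℤ)).toNat := by
      exact_mod_cast hb k hbk
    rwa [Nat.cast_mul, Nat.cast_sub hbk, Nat.cast_sub (by omega), Nat.cast_one] at h1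
  have hKk : (K : ℝ) ≤ k := by exact_mod_cast (by omega : K ≤ k)
  rw [div_lt_iff₀ hε] at hK
  have hkε : ((q : ℝ) - 1) * b < k * ε := hK.trans_le (mul_le_mul_of_nonneg_right hKk hε.le)
  have hlog : Real.logb (q : ℝ) ((q ^ k : ℕ) : ℝ) = k := by
    rw [Nat.cast_pow, Real.logb_pow, Real.logb_self_eq_one hq1, mul_one]
  rw [digitRatio, digitSum_base_pow hq, Nat.cast_one, div_one, hlog, gt_iff_lt]
  refine lt_of_lt_of_le ?_ hX
  linarith

theorem theorem1 (p : Polynomial ℤ) (hdeg : 2 ≤ p.natDegree) (hlead : 0 < p.leadingCoeff) :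
    ((∀ i : ℕ, 0 ≤ p.coeff i) →
      (∀ q : ℕ, 2 ≤ q → ∃ c₁ : ℝ, 0 < c₁ ∧ ∀ n : ℕ, 2 ≤ n →
        digitRatio p q n ≤ c₁ * Real.logb (q : ℝ) (n : ℝ) ^ (1 - 1 / (p.natDegree : ℝ))) ∧
      (∃ c₁' : ℝ, 0 < c₁' ∧ ∀ q : ℕ, 2 ≤ q → ∃ᶠ n : ℕ in atTop,
        digitRatio p q n > c₁' * Real.logb (q : ℝ) (n : ℝ) ^ (1 - 1 / (p.natDegree : ℝ)))) ∧
    ((∃ i : ℕ, p.coeff i < 0) → ∀ q : ℕ, 2 ≤ q →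
      (∃ c₂ : ℝ, 0 < c₂ ∧ ∃ n₀ : ℕ, ∀ n : ℕ, n₀ ≤ n → 0 < n ∧ 0 ≤ p.eval (n : ℤ) ∧
        digitRatio p q n ≤ c₂ * Real.logb (q : ℝ) (n : ℝ)) ∧
      (∀ ε : ℝ, 0 < ε → ∃ᶠ n : ℕ in atTop, 0 ≤ p.eval (n : ℤ) ∧
        digitRatio p q n > ((q : ℝ) - 1 - ε) * Real.logb (q : ℝ) (n : ℝ))) := by
  refine ⟨fun hp => ⟨fun q hq => digitRatio_le_of_coeff_nonneg hdeg hp hq,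
    frequently_lt_digitRatio_of_coeff_nonneg hdeg hlead hp⟩, fun ⟨i, hi⟩ q hq =>
    ⟨digitRatio_le_mul_logb hlead hq, fun ε hε =>
      frequently_lt_digitRatio_of_coeff_neg hlead hi hq hε⟩⟩
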